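/- Theorem 3. Consider a complete network on $n$ nodes that operates in synchronous rounds; all nodes start simultaneously and run the same randomized algorithm $A$, which may depend on $n$. Every node has $n-1$ ports, connected to the other $n-1$ nodes by a bijection that the node does not know; these bijections are uniformly random and independent for different nodes. Every node has its own infinite sequence of unbiased coin flips, all flips being independent of each other and of the ports. In each round a node may send one message of arbitrary size on each of its ports; it receives the messages sent to it in that round, each on the port that leads to its sender, and then updates its state by an arbitrary local computation. Each node has a status in $\{\bot,\text{NON-ELECTED},\text{ELECTED}\}$, and a run solves leader election if, from some round on, exactly one node has status ELECTED and all other nodes have status NON-ELECTED. Let $f:\mathbb{N}\to\mathbb{R}$, and let $\varepsilon>0$ and $a>0$ be constants. Suppose that for all sufficiently large $n$, on the complete network of $n$ nodes, $A$ sends at most $f(n)$ messages in total with probability at least $1-n^{-a}$, and $A$ solves leader election with probability at least $1/e+\varepsilon$. Then $f(n)\in\Omega(\sqrt n)$, i.e. there is a constant $c>0$ with $f(n)\ge c\sqrt n$ for all sufficiently large $n$. This holds for anonymous nodes, and also if the nodes are equipped with unique identifiers chosen by an adversary. In the latter case every node initially knows its own identifier, the identifiers come from a set $I_n$ with $|I_n|\ge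 n^4$ for all sufficiently large $n$, and the two probability bounds are assumed, for all sufficiently large $n$, for every assignment of pairwise distinct identifiers from $I_n$ to the $n$ nodes (the assignment being fixed before ports and coins are drawn). -/

import Mathlib

open MeasureTheory Filter

namespace LeaderElection

/-- The value of the status variable of a node. -/
inductive Status where
  | undecided
  | nonElected
  | elected

/-- An infinite sequence of private coin flips of a node. -/
abbrev Tape : Type := ℕ → Bool

/-- A randomized synchronous algorithm for the nodes of a complete network with `n` nodes, every
node being given an input from `I` (an identifier; `I = Unit` for anonymous nodes). All nodes run
the same code, which may depend on `n`. A node sees its input, its private coin flips, and, round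
by round, the messages that arrive on its `n - 1` ports; it does not know where its ports lead.
In each round it may send one message of arbitrary size on each of its ports, `none` meaning that
nothing is sent. Neither the local computation nor the number of rounds is restricted. -/
structure Algorithm (n : ℕ) (I : Type) where
  /-- local states -/
  State : Type
  /-- messages, for instance all finite bit strings -/
  Msg : Type
  [measurableSpaceState : MeasurableSpace State]
  [countableMsg : Countable Msg]
  /-- the state before the first round; the state may keep the coin flips for later use -/
  init : I → Tape → State
  /-- the message sent on each port in a round that is begun in the given state -/
  send : State → Fin (n - 1) → Option Msg
  /-- the state after a round that is begun in the given state and in which the given messages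
  arrive on the ports -/
  recv : State → (Fin (n - 1) → Option Msg) → State
  /-- the status variable -/
  status : State → Status
  measurable_init : ∀ i, Measurable (init i)
  measurableSet_send : ∀ p m, MeasurableSet {s | send s p = m}
  measurable_recv : ∀ inbox, Measurable fun s => recv s inbox
  measurableSet_status : ∀ x, MeasurableSet {s | status s = x}

/-- A port assignment of the complete network on `Fin n`: for every node `v`, a bijection from the
ports of `v` to the other nodes. The assignments at different nodes are unrelated. -/
abbrev Ports (n : ℕ) : Type := ∀ v : Fin n, Fin (n - 1) ≃ {w : Fin n // w ≠ v}

instance (n : ℕ) : Nonempty (Ports n) :=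
  ⟨fun v => Fintype.equivOfCardEq (by simp [Fintype.card_subtype_compl])⟩

instance (n : ℕ) : MeasurableSpace (Ports n) := ⊤

/-- What chance decides in a run: the port assignment and the coin flips of every node. -/
abbrev Outcome (n : ℕ) : Type := Ports n × (Fin n → Tape)

/-- Independent unbiased coin flips. -/
noncomputable def tapeMeasure : Measure Tape :=
  Measure.infinitePi fun _ : ℕ => (PMF.uniformOfFintype Bool).toMeasure

/-- The port assignment is uniformly random (so the bijections at the nodes are independent and
uniform), and independently of it all nodes have independent unbiased coin flips. -/
noncomputable def runMeasure (n : ℕ) : Measure (Outcome n) :=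
  (PMF.uniformOfFintype (Ports n)).toMeasure.prod (Measure.pi fun _ : Fin n => tapeMeasure)

namespace Algorithm

variable {n : ℕ} {I : Type}

/-- The states of all nodes after `t` rounds. In each round the message that node `v` receives on
its port `p`, leading to `w`, is the one that `w` sends in this round on its port leading to `v`. -/
def state (A : Algorithm n I) (ids : Fin n → I) (x : Outcome n) : ℕ → Fin n → A.State
  | 0 => fun v => A.init (ids v) (x.2 v)
  | t + 1 => fun v =>
      A.recv (A.state ids x t v) fun p =>
        A.send (A.state ids x t (x.1 v p))
          ((x.1 (x.1 v p)).symm ⟨v, (x.1 v p).2.symm⟩)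

/-- The number of messages sent in the first `r` rounds. -/
def messages (A : Algorithm n I) (ids : Fin n → I) (x : Outcome n) (r : ℕ) : ℕ :=
  ∑ t ∈ Finset.range r, ∑ v : Fin n,
    (Finset.univ.filter fun p => (A.send (A.state ids x t v) p).isSome).card

/-- The event that at most `b` messages are sent in the whole run. -/
def sendsAtMost (A : Algorithm n I) (ids : Fin n → I) (b : ℝ) : Set (Outcome n) :=
  {x | ∀ r, (A.messages ids x r : ℝ) ≤ b}

/-- The event that leader election is solved: from some round on, exactly one node has status
`elected` and all other nodes have status `nonElected`. -/
def electsLeader (A : Algorithm n I) (ids : Fin n → I) : Set (Outcome n) :=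
  {x | ∃ T, ∀ t, T ≤ t → ∃ v, A.status (A.state ids x t v) = Status.elected ∧
    ∀ w, w ≠ v → A.status (A.state ids x t w) = Status.nonElected}

end Algorithm

end LeaderElection

/-!
Fix the coin sequences, and the identifiers, of a list of `N ≫ n²` seeds. The network becomes a
deterministic protocol, run on a configuration in which every node draws a seed and a port
assignment; drawing the seeds with repetition costs only probability `n² / N`. A seed is quiet if a
node that has it neither sends a message nor is elected before it receives one; in an election with
at most `m` messages at most `2 m + 1` nodes are active, i.e. have a seed that is not quiet.

Draw independent configurations `X i`, one for each node `i`, subject to all nodes other than `i`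
being quiet in `X i`. The nodes that news from the active nodes of `X i` reaches form the cloud of
`i`. The law of `X i` is invariant under permutations of the nodes other than `i`, so the clouds,
which have total size at most `3 m + 1`, are pairwise disjoint outside an event of probability
`(3 m + 1)² / (n - 1)`. Disjoint clouds do not interact: once they are moved to the diagonal
`v ↦ X v v`, this configuration runs like all of them side by side, and it elects exactly one leader
only if the cloud of exactly one `X i` does. Moving the clouds is injective, and the diagonal is a
uniformly random configuration. Hence the probability of a cheap election exceeds by at most
`(3 m + 1)² / (n - 1)` that of exactly one of `n` independent events with the same probability `p`,
and `n p (1 - p) ^ (n - 1) ≤ n / (n - 1) * e⁻¹`. If `m ≤ c √n` with `c` small, then this is less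
than `1 / e + ε`.
-/

namespace LeaderElection

open Finset Function

theorem mul_mul_one_sub_pow_le_exp (k : ℕ) {p : ℝ} (hp₀ : 0 ≤ p) (hp₁ : p ≤ 1) :
    k * (p * (1 - p) ^ k) ≤ Real.exp (-1) :=
  calc k * (p * (1 - p) ^ k) = k * p * (1 - p) ^ k := by ring
    _ ≤ k * p * Real.exp (-p) ^ k := by
      have := sub_nonneg.2 hp₁
      gcongr
      exact Real.one_sub_le_exp_neg p
    _ = k * p * Real.exp (-(k * p)) := by rw [← Real.exp_nat_mul, mul_neg]
    _ ≤ Real.exp (-1) := Real.mul_exp_neg_le_exp_neg_one _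

section ExactlyOne

variable {ι : Type*} {α : ι → Type*} [Fintype ι] [DecidableEq ι] {s : ∀ i, Finset (α i)}
  {p : ∀ i, α i → Prop} {R w : ℕ}

open Classical in
theorem card_filter_piFinset_existsUnique_le (hs : ∀ i, #(s i) = R)
    (hw : ∀ i, #{a ∈ s i | p i a} = w) :
    #{x ∈ Fintype.piFinset s | ∃! i, p i (x i)} ≤
      Fintype.card ι * (w * (R - w) ^ (Fintype.card ι - 1)) := by
  let only (i : ι) : Finset (∀ i, α i) :=
    Fintype.piFinset (update (fun j => {a ∈ s j | ¬p j a}) i {a ∈ s i | p i a})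
  have hnot (j : ι) : #{a ∈ s j | ¬p j a} = R - w := by
    have := card_filter_add_card_filter_not (s := s j) (p j)
    grind
  have honly (i : ι) : #(only i) = w * (R - w) ^ (Fintype.card ι - 1) := by
    rw [Fintype.card_piFinset, ← mul_prod_erase _ _ (mem_univ i), update_self, hw]
    congr 1
    rw [prod_congr rfl fun j hj => by rw [update_of_ne (ne_of_mem_erase hj), hnot], prod_const,
      card_erase_of_mem (mem_univ i), card_univ]
  calc #{x ∈ Fintype.piFinset s | ∃! i, p i (x i)} ≤ #(univ.biUnion only) := by
        refine card_le_card fun x hx => ?_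
        obtain ⟨hx, i, hi, hunique⟩ := mem_filter.1 hx
        refine mem_biUnion.2 ⟨i, mem_univ i, Fintype.mem_piFinset.2 fun j => ?_⟩
        have hj := Fintype.mem_piFinset.1 hx j
        obtain rfl | hji := eq_or_ne j i
        · simpa using ⟨hj, hi⟩
        · simpa [hji] using ⟨hj, fun h => hji (hunique j h)⟩
    _ ≤ Fintype.card ι * (w * (R - w) ^ (Fintype.card ι - 1)) :=
        card_biUnion_le_card_mul _ _ _ fun i _ => (honly i).le

open Classical in
theorem mul_card_filter_piFinset_existsUnique_le (hs : ∀ i, #(s i) = R)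
    (hw : ∀ i, #{a ∈ s i | p i a} = w) :
    ((Fintype.card ι - 1 : ℕ) : ℝ) * #{x ∈ Fintype.piFinset s | ∃! i, p i (x i)} ≤
      Fintype.card ι * Real.exp (-1) * #(Fintype.piFinset s) := by
  obtain hι | ⟨⟨i⟩⟩ := isEmpty_or_nonempty ι
  · simp
  have hwR : w ≤ R := hs i ▸ hw i ▸ card_filter_le _ _
  set k := Fintype.card ι - 1 with hk
  have hcard : (#(Fintype.piFinset s) : ℝ) = R * R ^ k := by
    rw [Fintype.card_piFinset, prod_congr rfl fun i _ => hs i, prod_const, card_univ,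
      ← Nat.succ_pred_eq_of_pos (Fintype.card_pos_iff.2 ⟨i⟩), pow_succ']
    simp [hk]
  have hscale : (w : ℝ) * ((R - w : ℕ) : ℝ) ^ k =
      (w / R * (1 - w / R : ℝ) ^ k) * #(Fintype.piFinset s) := by
    obtain rfl | hR := Nat.eq_zero_or_pos R
    · simp [Nat.le_zero.1 hwR]
    · rw [hcard, Nat.cast_sub hwR, one_sub_div (by positivity), div_pow]
      field_simp
  have hle : (#{x ∈ Fintype.piFinset s | ∃! i, p i (x i)} : ℝ) ≤
      Fintype.card ι * (w * ((R - w : ℕ) : ℝ) ^ k) :=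
    mod_cast card_filter_piFinset_existsUnique_le hs hw
  calc (k : ℝ) * #{x ∈ Fintype.piFinset s | ∃! i, p i (x i)}
      ≤ k * (Fintype.card ι * (w * ((R - w : ℕ) : ℝ) ^ k)) := by gcongr
    _ = Fintype.card ι * (k * (w / R * (1 - w / R : ℝ) ^ k)) * #(Fintype.piFinset s) := by
      rw [hscale]
      ring
    _ ≤ Fintype.card ι * Real.exp (-1) * #(Fintype.piFinset s) := by
      gcongr
      exact mul_mul_one_sub_pow_le_exp k (by positivity)
        (div_le_one_of_le₀ (mod_cast hwR) (by positivity))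

end ExactlyOne

section Collision

variable {Ω V : Type*} [Fintype V] [DecidableEq V] {F : Finset Ω}

open Classical in
theorem sub_one_mul_card_not_disjoint_le {S T : Ω → Finset V} {i j : V} (hij : i ≠ j)
    (hS : ∀ a a' b, a ≠ i → a' ≠ i →
      #{ω ∈ F | a ∈ S ω ∧ b ∈ T ω} ≤ #{ω ∈ F | a' ∈ S ω ∧ b ∈ T ω})
    (hT : ∀ a b b', b ≠ j → b' ≠ j →
      #{ω ∈ F | a ∈ S ω ∧ b ∈ T ω} ≤ #{ω ∈ F | a ∈ S ω ∧ b' ∈ T ω}) :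
    (Fintype.card V - 1) * #{ω ∈ F | ¬Disjoint (S ω) (T ω)} ≤ ∑ ω ∈ F, #(S ω) * #(T ω) := by
  let H (a b : V) : ℕ := #{ω ∈ F | a ∈ S ω ∧ b ∈ T ω}
  have hcard (v : V) : #(univ.erase v) = Fintype.card V - 1 := by simp
  have hunion : #{ω ∈ F | ¬Disjoint (S ω) (T ω)} ≤ ∑ b, H b b := by
    refine (card_le_card fun ω hω => ?_).trans card_biUnion_le
    simpa [not_disjoint_iff, and_assoc] using hω
  have hdiag : (Fintype.card V - 1) * H i i ≤ ∑ b, H i b := by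
    rw [← hcard j, ← smul_eq_mul]
    refine (card_nsmul_le_sum _ _ _ fun b hb => hT i i b hij (ne_of_mem_erase hb)).trans ?_
    exact sum_le_sum_of_subset (erase_subset j univ)
  have hoff : (Fintype.card V - 1) * ∑ b ∈ univ.erase i, H b b ≤
      ∑ a ∈ univ.erase i, ∑ b, H a b := by
    rw [sum_comm, mul_sum]
    refine (sum_le_sum fun b hb => ?_).trans (sum_le_sum_of_subset (erase_subset i univ))
    rw [← hcard i, ← smul_eq_mul]
    exact card_nsmul_le_sum _ _ _ fun a ha => hS b a b (ne_of_mem_erase hb) (ne_of_mem_erase ha)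
  calc (Fintype.card V - 1) * #{ω ∈ F | ¬Disjoint (S ω) (T ω)}
      ≤ (Fintype.card V - 1) * ∑ b, H b b := by gcongr
    _ = (Fintype.card V - 1) * H i i + (Fintype.card V - 1) * ∑ b ∈ univ.erase i, H b b := by
      rw [← add_sum_erase _ _ (mem_univ i), mul_add]
    _ ≤ ∑ b, H i b + ∑ a ∈ univ.erase i, ∑ b, H a b := add_le_add hdiag hoff
    _ = ∑ a, ∑ b, H a b := add_sum_erase _ (fun a => ∑ b, H a b) (mem_univ i)
    _ = ∑ ω ∈ F, #(S ω) * #(T ω) := by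
      rw [← Fintype.sum_prod_type']
      refine (sum_card_bipartiteAbove_eq_sum_card_bipartiteBelow fun (q : V × V) ω =>
        q.1 ∈ S ω ∧ q.2 ∈ T ω).trans (sum_congr rfl fun ω _ => ?_)
      rw [← card_product]
      congr 1
      ext q
      simp [bipartiteBelow]

open Classical in
theorem sub_one_mul_card_not_pairwise_disjoint_le {T : Ω → V → Finset V}
    (hT : ∀ i j, i ≠ j → ∀ a a' b, a ≠ i → a' ≠ i →
      #{ω ∈ F | a ∈ T ω i ∧ b ∈ T ω j} ≤ #{ω ∈ F | a' ∈ T ω i ∧ b ∈ T ω j}) :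
    (Fintype.card V - 1) * #{ω ∈ F | ¬Pairwise (Disjoint on T ω)} ≤
      ∑ ω ∈ F, (∑ i, #(T ω i)) ^ 2 := by
  have hpair (q : V × V) (hq : q ∈ univ.offDiag) :
      (Fintype.card V - 1) * #{ω ∈ F | ¬Disjoint (T ω q.1) (T ω q.2)} ≤
        ∑ ω ∈ F, #(T ω q.1) * #(T ω q.2) := by
    have hne : q.1 ≠ q.2 := (mem_offDiag.1 hq).2.2
    refine sub_one_mul_card_not_disjoint_le hne (hT _ _ hne) fun a b b' hb hb' => ?_
    simpa only [and_comm] using hT _ _ hne.symm b b' a hb hb'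
  calc (Fintype.card V - 1) * #{ω ∈ F | ¬Pairwise (Disjoint on T ω)}
      ≤ (Fintype.card V - 1) * ∑ q ∈ univ.offDiag, #{ω ∈ F | ¬Disjoint (T ω q.1) (T ω q.2)} := by
        gcongr
        refine (card_le_card fun ω hω => ?_).trans card_biUnion_le
        obtain ⟨hω, hT⟩ := mem_filter.1 hω
        obtain ⟨i, j, hij, h⟩ : ∃ i j, i ≠ j ∧ ¬Disjoint (T ω i) (T ω j) := by
          simpa [Pairwise, onFun] using hT
        exact mem_biUnion.2 ⟨(i, j), by simpa using hij, mem_filter.2 ⟨hω, h⟩⟩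
    _ ≤ ∑ q ∈ univ.offDiag, ∑ ω ∈ F, #(T ω q.1) * #(T ω q.2) := by
        rw [mul_sum]
        exact sum_le_sum hpair
    _ ≤ ∑ q : V × V, ∑ ω ∈ F, #(T ω q.1) * #(T ω q.2) :=
        sum_le_sum_of_subset (subset_univ univ.offDiag)
    _ = ∑ ω ∈ F, (∑ i, #(T ω i)) ^ 2 := by
        rw [sum_comm]
        exact sum_congr rfl fun ω _ => by rw [sq, sum_mul_sum, Fintype.sum_prod_type]

end Collision

open Classical in
theorem card_filter_le_of_injOn {Ω : Type*} {F : Finset Ω} {D P : Ω → Prop} {Ψ : Ω → Ω}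
    (hmaps : ∀ ω ∈ F, D ω → Ψ ω ∈ F) (hinj : Set.InjOn Ψ {ω | ω ∈ F ∧ D ω}) :
    #{ω ∈ F | P ω} ≤ #{ω ∈ F | ¬D ω} + #{ω ∈ F | D ω ∧ P (Ψ ω)} := by
  let A : Finset Ω := {ω ∈ F | D ω}
  have hA : A.image Ψ ⊆ F := image_subset_iff.2 fun ω hω => by
    obtain ⟨hω, hD⟩ := mem_filter.1 hω
    exact hmaps ω hω hD
  have hmissed : #(F \ A.image Ψ) = #{ω ∈ F | ¬D ω} := by
    have hcard : #(A.image Ψ) = #A := card_image_of_injOn (by simpa [A] using hinj)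
    have := card_filter_add_card_filter_not (s := F) D
    grind [card_sdiff_of_subset hA]
  have hsubset : {ω ∈ F | P ω} ⊆ F \ A.image Ψ ∪ {ω ∈ F | D ω ∧ P (Ψ ω)}.image Ψ := by
    intro ω hω
    simp only [A, mem_union, mem_image, mem_filter] at hω ⊢
    grind
  calc #{ω ∈ F | P ω} ≤ #(F \ A.image Ψ) + #({ω ∈ F | D ω ∧ P (Ψ ω)}.image Ψ) :=
        (card_le_card hsubset).trans (card_union_le _ _)
    _ ≤ #{ω ∈ F | ¬D ω} + #{ω ∈ F | D ω ∧ P (Ψ ω)} := add_le_add hmissed.le card_image_le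

section Diagonal

variable {V : Type*} {α : V → Type*} [Fintype V] [DecidableEq V] [∀ v, Fintype (α v)]

open Classical in
theorem card_filter_diagonal (Q : ∀ v, Finset (α v)) (p : (∀ v, α v) → Prop) :
    #{X : V → ∀ v, α v | (∀ i v, v ≠ i → X i v ∈ Q v) ∧ p fun v => X v v} =
      (∏ v, #(Q v) ^ (Fintype.card V - 1)) * #{x | p x} := by
  let fibre (z : ∀ v, α v) : Finset (V → ∀ v, α v) :=
    Fintype.piFinset fun i => Fintype.piFinset (update Q i {z i})
  have hfibre (z : ∀ v, α v) : #(fibre z) = ∏ v, #(Q v) ^ (Fintype.card V - 1) := by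
    have hrow (i : V) : ∏ v, #(update Q i {z i} v) = ∏ v ∈ univ.erase i, #(Q v) := by
      rw [← mul_prod_erase _ _ (mem_univ i), update_self, card_singleton, one_mul]
      exact prod_congr rfl fun v hv => by rw [update_of_ne (ne_of_mem_erase hv)]
    simp only [fibre, Fintype.card_piFinset, hrow]
    rw [prod_comm' (t' := univ) (s' := fun v => univ.erase v) (by simp [ne_comm])]
    simp
  rw [card_eq_sum_card_fiberwise (f := fun X v => X v v) (t := {x | p x})
    fun X hX => by simpa using (mem_filter.1 hX).2.2, mul_comm, ← smul_eq_mul]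
  refine sum_eq_card_nsmul fun z hz => ?_
  rw [← hfibre z]
  congr 1
  ext X
  have hp : p z := (mem_filter.1 hz).2
  simp only [fibre, mem_filter, mem_univ, true_and, Fintype.mem_piFinset]
  constructor
  · rintro ⟨⟨hoff, -⟩, rfl⟩ i v
    obtain rfl | hv := eq_or_ne v i
    · simp
    · simpa [hv] using hoff i v hv
  · intro h
    have hdiag : (fun v => X v v) = z := funext fun v => by simpa using h v v
    exact ⟨⟨fun i v hv => by simpa [hv] using h i v, hdiag ▸ hp⟩, hdiag⟩

end Diagonal

/-- A synchronous protocol without randomness, for nodes with ports `ι`: the code of a randomized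
algorithm once everything a node knows at the start, its identifier and its coin flips, is given to
it as a seed from `S`. -/
structure Protocol (ι S : Type*) where
  State : Type
  Msg : Type
  init : S → State
  send : State → ι → Option Msg
  recv : State → (ι → Option Msg) → State
  status : State → Status

/-- A configuration of the complete network on `V`: the seed and the port assignment of every
node. -/
abbrev Config (V ι S : Type*) : Type _ := ∀ v : V, S × (ι ≃ {w : V // w ≠ v})

namespace Protocol

variable {V ι S : Type*} [DecidableEq V] (P : Protocol ι S)

section Run

/-- The message that a node `v` with ports `e` sends to the node `w` when it is in state `s`. -/
def message {v : V} (s : P.State) (e : ι ≃ {w : V // w ≠ v}) (w : V) : Option P.Msg :=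
  if h : w ≠ v then P.send s (e.symm ⟨w, h⟩) else none

/-- The states of all nodes after the given number of rounds. -/
def run (x : Config V ι S) : ℕ → V → P.State
  | 0, v => P.init (x v).1
  | r + 1, v => P.recv (run x r v) fun p =>
      P.message (run x r ((x v).2 p)) (x ((x v).2 p)).2 v

/-- The message that `v` sends to `w` in round `r`. -/
def messageAt (x : Config V ι S) (r : ℕ) (v w : V) : Option P.Msg :=
  P.message (P.run x r v) (x v).2 w

theorem run_succ (x : Config V ι S) (r : ℕ) (v : V) :
    P.run x (r + 1) v = P.recv (P.run x r v) fun p => P.messageAt x r ((x v).2 p) v :=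
  rfl

/-- The state after `r` rounds of a node that starts with seed `s` and receives no message. -/
def idle (s : S) : ℕ → P.State
  | 0 => P.init s
  | r + 1 => P.recv (idle s r) fun _ => none

theorem run_eq_idle {x : Config V ι S} {r : ℕ} {v : V}
    (h : ∀ k < r, ∀ w, P.messageAt x k w v = none) : P.run x r v = P.idle (x v).1 r := by
  induction r with
  | zero => rfl
  | succ r ih =>
    simp only [run_succ, idle, ih fun k hk => h k (hk.trans r.lt_succ_self), h r r.lt_succ_self]

/-- A seed is quiet until time `t` if a node that has it sends no message before time `t`, and is
not elected at time `t`, unless it receives a message. -/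
def Quiet (t : ℕ) (s : S) : Prop :=
  (∀ r < t, ∀ p, P.send (P.idle s r) p = none) ∧ P.status (P.idle s t) ≠ Status.elected

noncomputable instance (t : ℕ) : DecidablePred (P.Quiet t) := Classical.decPred _

theorem messageAt_eq_none_of_quiet {x : Config V ι S} {t r : ℕ} {v : V} (hv : P.Quiet t (x v).1)
    (hr : r < t) (hrun : P.run x r v = P.idle (x v).1 r) (w : V) : P.messageAt x r v w = none := by
  unfold messageAt message
  split_ifs with h
  · rw [hrun, hv.1 r hr]
  · rfl

end Run

section Count

variable [Fintype V]

/-- The nodes to which `v` sends a message in round `r`. -/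
def recipients (x : Config V ι S) (r : ℕ) (v : V) : Finset V :=
  {w | (P.messageAt x r v w).isSome}

theorem mem_recipients {x : Config V ι S} {r : ℕ} {v w : V} :
    w ∈ P.recipients x r v ↔ P.messageAt x r v w ≠ none := by
  simp [recipients, Option.isSome_iff_ne_none]

theorem card_recipients [Fintype ι] (x : Config V ι S) (r : ℕ) (v : V) :
    #(P.recipients x r v) = #{p | (P.send (P.run x r v) p).isSome} := by
  symm
  refine card_bij (fun p _ => ((x v).2 p : V)) (fun p hp => ?_)
    (fun p _ q _ h => (x v).2.injective (Subtype.ext h)) fun w hw => ?_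
  · simpa [recipients, messageAt, message, ((x v).2 p).2] using hp
  · by_cases h : w ≠ v
    · exact ⟨(x v).2.symm ⟨w, h⟩, by simpa [recipients, messageAt, message, h] using hw, by simp⟩
    · rw [not_not.1 h] at hw
      simp [recipients, messageAt, message] at hw

/-- The number of messages sent in the first `r` rounds. -/
def sent (x : Config V ι S) (r : ℕ) : ℕ :=
  ∑ k ∈ range r, ∑ v, #(P.recipients x k v)

theorem sent_succ (x : Config V ι S) (r : ℕ) :
    P.sent x (r + 1) = P.sent x r + ∑ v, #(P.recipients x r v) :=
  sum_range_succ _ _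

theorem sent_mono (x : Config V ι S) : Monotone (P.sent x) :=
  monotone_nat_of_le_succ fun r => P.sent_succ x r ▸ Nat.le_add_right _ _

/-- The nodes of a configuration whose seed is not quiet until time `t`. -/
noncomputable def active (t : ℕ) (x : Config V ι S) : Finset V :=
  {v | ¬P.Quiet t (x v).1}

omit [DecidableEq V] in
theorem mem_active {t : ℕ} {x : Config V ι S} {v : V} :
    v ∈ P.active t x ↔ ¬P.Quiet t (x v).1 := by
  simp [active]

/-- At time `t` there is exactly one elected node, and at most `m` messages have been sent. -/
def ElectsCheaply (t m : ℕ) (x : Config V ι S) : Prop :=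
  (∃! v, P.status (P.run x t v) = Status.elected) ∧ P.sent x t ≤ m

noncomputable instance (t m : ℕ) : DecidablePred (P.ElectsCheaply (V := V) t m) :=
  Classical.decPred _

theorem exists_messageAt_ne_none_of_mem_active {x : Config V ι S} {t : ℕ} {v : V}
    (hv : v ∈ P.active t x) (hstatus : P.status (P.run x t v) ≠ Status.elected) :
    ∃ k < t, ∃ w, P.messageAt x k v w ≠ none ∨ P.messageAt x k w v ≠ none := by
  by_contra! hsilent
  have hidle {k : ℕ} (hk : k ≤ t) : P.run x k v = P.idle (x v).1 k :=
    P.run_eq_idle fun j hj w => (hsilent j (hj.trans_le hk) w).2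
  refine P.mem_active.1 hv ⟨fun k hk p => ?_, hidle le_rfl ▸ hstatus⟩
  have hnone := (hsilent k hk ((x v).2 p)).1
  simpa [messageAt, message, ((x v).2 p).2, hidle hk.le] using hnone

theorem ElectsCheaply.card_active_le {P : Protocol ι S} {t m : ℕ} {x : Config V ι S}
    (h : P.ElectsCheaply t m x) : #(P.active t x) ≤ 2 * m + 1 := by
  obtain ⟨⟨leader, -, hunique⟩, hsent⟩ := h
  let M : Finset (Σ _ : ℕ, Σ _ : V, V) :=
    (range t).sigma fun k => univ.sigma fun v => P.recipients x k v
  have hM : #M ≤ m := by simpa [M, card_sigma, sent] using hsent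
  have hactive : P.active t x ⊆ insert leader (M.image (·.2.1) ∪ M.image (·.2.2)) := by
    intro v hv
    by_cases hstatus : P.status (P.run x t v) = Status.elected
    · simp [hunique v hstatus]
    · obtain ⟨k, hk, w, h | h⟩ := P.exists_messageAt_ne_none_of_mem_active hv hstatus
      · exact mem_insert_of_mem (mem_union_left _ (mem_image.2
          ⟨⟨k, v, w⟩, by simpa [M, hk] using P.mem_recipients.2 h, rfl⟩))
      · exact mem_insert_of_mem (mem_union_right _ (mem_image.2
          ⟨⟨k, w, v⟩, by simpa [M, hk] using P.mem_recipients.2 h, rfl⟩))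
  calc #(P.active t x) ≤ #(M.image (·.2.1)) + #(M.image (·.2.2)) + 1 :=
        (card_le_card hactive).trans ((card_insert_le _ _).trans
          (Nat.add_le_add_right (card_union_le _ _) 1))
    _ ≤ #M + #M + 1 := by gcongr <;> exact card_image_le
    _ ≤ 2 * m + 1 := by lia

/-- The nodes that news from the nodes in `A` has reached within the given number of rounds. -/
def spread (x : Config V ι S) (A : Finset V) : ℕ → Finset V
  | 0 => A
  | r + 1 => spread x A r ∪ (spread x A r).biUnion (P.recipients x r)

theorem spread_mono (x : Config V ι S) (A : Finset V) : Monotone (P.spread x A) :=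
  monotone_nat_of_le_succ fun _ => subset_union_left

theorem card_spread_le (x : Config V ι S) (A : Finset V) (r : ℕ) :
    #(P.spread x A r) ≤ #A + P.sent x r := by
  induction r with
  | zero => simp [spread]
  | succ r ih =>
    calc #(P.spread x A (r + 1))
        ≤ #(P.spread x A r) + ∑ v ∈ P.spread x A r, #(P.recipients x r v) :=
          (card_union_le _ _).trans (Nat.add_le_add_left card_biUnion_le _)
      _ ≤ #(P.spread x A r) + ∑ v, #(P.recipients x r v) :=
          Nat.add_le_add_left (sum_le_sum_of_subset (subset_univ _)) _
      _ ≤ #A + P.sent x (r + 1) := by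
          rw [sent_succ]
          lia

/-- The nodes that an active node has influenced within the first `r` rounds. -/
noncomputable def touched (t : ℕ) (x : Config V ι S) (r : ℕ) : Finset V :=
  P.spread x (P.active t x) r

variable {P} {x : Config V ι S} {t r k : ℕ} {v w : V}

theorem quiet_of_notMem_touched (hv : v ∉ P.touched t x r) : P.Quiet t (x v).1 := by
  by_contra h
  exact hv (P.spread_mono x _ r.zero_le (P.mem_active.2 h))

theorem run_eq_idle_of_notMem_touched (hr : r ≤ t) (hv : v ∉ P.touched t x r) :
    P.run x r v = P.idle (x v).1 r := by
  induction r using Nat.strong_induction_on generalizing v with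
  | _ r ih =>
    refine P.run_eq_idle fun k hk w => ?_
    by_cases hw : w ∈ P.touched t x k
    · by_contra h
      exact hv (P.spread_mono x _ (Nat.succ_le_of_lt hk)
        (mem_union_right _ (mem_biUnion.2 ⟨w, hw, P.mem_recipients.2 h⟩)))
    · exact P.messageAt_eq_none_of_quiet (quiet_of_notMem_touched hw) (hk.trans_le hr)
        (ih k hk (hk.le.trans hr) hw) v

theorem messageAt_eq_none_of_notMem_touched (hr : r < t) (hv : v ∉ P.touched t x r) (w : V) :
    P.messageAt x r v w = none :=
  P.messageAt_eq_none_of_quiet (quiet_of_notMem_touched hv) hr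
    (run_eq_idle_of_notMem_touched hr.le hv) w

theorem mem_touched_of_messageAt_ne_none (hkr : k < r) (hk : k < t)
    (h : P.messageAt x k v w ≠ none) : w ∈ P.touched t x r := by
  have hv : v ∈ P.touched t x k := by
    by_contra hv
    exact h (messageAt_eq_none_of_notMem_touched hk hv w)
  exact P.spread_mono x _ (Nat.succ_le_of_lt hkr)
    (mem_union_right _ (mem_biUnion.2 ⟨v, hv, P.mem_recipients.2 h⟩))

end Count

end Protocol

namespace Protocol

section Glue

variable {V ι S : Type*}

/-- The configuration in which every node `v` is as in the configuration `X (o v)`. -/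
def glue (X : V → Config V ι S) (o : V → V) : Config V ι S :=
  fun v => X (o v) v

variable [Fintype V] [DecidableEq V] {P : Protocol ι S} {X : V → Config V ι S} {o : V → V}
  {t r k : ℕ}

-- A message that reached `v` in its own row but not in the glued run, or conversely, would pass
-- from the touched nodes of one row to those of another.
theorem run_glue (hr : r ≤ t) (ho : ∀ i, ∀ v ∈ P.touched t (X i) r, o v = i) (hk : k ≤ r)
    (v : V) : P.run (glue X o) k v = P.run (X (o v)) k v := by
  induction k generalizing v with
  | zero => rfl
  | succ k ih =>
    have hkt : k < t := (Nat.lt_of_succ_le hk).trans_le hr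
    have hmessage (w : V) : P.messageAt (glue X o) k w v = P.messageAt (X (o v)) k w v := by
      have hglue : P.messageAt (glue X o) k w v = P.messageAt (X (o w)) k w v := by
        rw [messageAt, ih (Nat.le_of_succ_le hk)]
        rfl
      rw [hglue]
      by_cases how : o w = o v
      · rw [how]
      trans none
      · by_contra h
        exact how (ho _ v (mem_touched_of_messageAt_ne_none hk hkt h)).symm
      · by_contra! h
        refine how (ho _ w ?_)
        by_contra hw
        exact h.symm (messageAt_eq_none_of_notMem_touched hkt
          (fun hwk => hw (P.spread_mono _ _ (Nat.le_of_succ_le hk) hwk)) v)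
    simp only [run_succ, ih (Nat.le_of_succ_le hk), hmessage]
    rfl

theorem recipients_glue (hr : r ≤ t) (ho : ∀ i, ∀ v ∈ P.touched t (X i) r, o v = i) (hk : k ≤ r)
    (v : V) : P.recipients (glue X o) k v = P.recipients (X (o v)) k v := by
  simp only [recipients, messageAt, run_glue hr ho hk]
  rfl

theorem sum_card_recipients_glue (hr : r ≤ t)
    (ho : ∀ i, ∀ v ∈ P.touched t (X i) r, o v = i) (hk : k ≤ r) (hkt : k < t) :
    ∑ v, #(P.recipients (glue X o) k v) = ∑ i, ∑ v, #(P.recipients (X i) k v) := by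
  rw [sum_comm]
  refine sum_congr rfl fun v _ => ?_
  rw [recipients_glue hr ho hk, sum_eq_single (o v) (fun i _ hi => ?_) (by simp)]
  rw [card_eq_zero, eq_empty_iff_forall_notMem]
  intro w hw
  refine hi (ho i v ?_).symm
  by_contra hv
  exact P.mem_recipients.1 hw (messageAt_eq_none_of_notMem_touched hkt
    (fun hvk => hv (P.spread_mono _ _ hk hvk)) w)

theorem sent_glue (hr : r ≤ t) (ho : ∀ i, ∀ v ∈ P.touched t (X i) r, o v = i) (hk : k ≤ r + 1)
    (hkt : k ≤ t) : P.sent (glue X o) k = ∑ i, P.sent (X i) k := by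
  simp only [sent]
  rw [sum_comm (s := univ)]
  refine sum_congr rfl fun j hj => ?_
  have hjk : j < k := mem_range.1 hj
  exact sum_card_recipients_glue hr ho (by lia) (hjk.trans_le hkt)

theorem touched_eq_spread_glue (hr : r ≤ t) (ho : ∀ i, ∀ v ∈ P.touched t (X i) r, o v = i)
    (i : V) (hk : k ≤ r) :
    P.touched t (X i) k = P.spread (glue X o) (P.active t (X i)) k := by
  induction k with
  | zero => rfl
  | succ k ih =>
    specialize ih (Nat.le_of_succ_le hk)
    simp only [touched, spread] at ih ⊢
    rw [← ih]
    refine congrArg _ (biUnion_congr rfl fun v hv => ?_)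
    rw [recipients_glue hr ho (Nat.le_of_succ_le hk),
      ho i v (P.spread_mono _ _ (Nat.le_of_succ_le hk) hv)]

variable (P) in
/-- In the configuration `x`, some node that an active node has influenced is elected at time
`t`. -/
def ElectsTouched (t : ℕ) (x : Config V ι S) : Prop :=
  ∃ v ∈ P.touched t x t, P.status (P.run x t v) = Status.elected

theorem existsUnique_electsTouched (ho : ∀ i, ∀ v ∈ P.touched t (X i) t, o v = i)
    (h : ∃! v, P.status (P.run (glue X o) t v) = Status.elected) :
    ∃! i, P.ElectsTouched t (X i) := by
  obtain ⟨v, hv, hunique⟩ := h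
  refine ⟨o v, ⟨v, ?_, run_glue le_rfl ho le_rfl v ▸ hv⟩, ?_⟩
  · by_contra hmem
    refine (quiet_of_notMem_touched hmem).2 ?_
    rwa [← run_eq_idle_of_notMem_touched le_rfl hmem, ← run_glue le_rfl ho le_rfl]
  · rintro i ⟨w, hw, hstatus⟩
    have how : o w = i := ho i w hw
    have hstatus' : P.status (P.run (glue X o) t w) = Status.elected := by
      rwa [run_glue le_rfl ho le_rfl, how]
    rw [← how, hunique w hstatus']

end Glue

end Protocol

section Relabel

variable {V ι S : Type*}

/-- The configuration in which the node `σ v` takes over the role of the node `v`. -/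
def Config.relabel (σ : Equiv.Perm V) (x : Config V ι S) : Config V ι S := fun v =>
  ((x (σ.symm v)).1, (x (σ.symm v)).2.trans
    (σ.subtypeEquiv fun w => by rw [Ne, Ne, Equiv.eq_symm_apply]))

theorem Config.relabel_injective (σ : Equiv.Perm V) :
    Injective (Config.relabel σ : Config V ι S → Config V ι S) := by
  intro x y h
  funext v
  obtain ⟨u, rfl⟩ := σ.symm.surjective v
  obtain ⟨hseed, hports⟩ := Prod.ext_iff.1 (congrFun h u)
  refine Prod.ext hseed (Equiv.ext fun p => ?_)
  simpa [Config.relabel, Subtype.ext_iff] using Equiv.congr_fun hports p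

namespace Protocol

variable [DecidableEq V] (P : Protocol ι S) (σ : Equiv.Perm V) (x : Config V ι S) (t r : ℕ)

theorem message_relabel (s : P.State) (v w : V) :
    P.message s (x.relabel σ v).2 w = P.message s (x (σ.symm v)).2 (σ.symm w) := by
  by_cases h : w = v
  · simp [message, h]
  · simp [message, h, Config.relabel]

theorem run_relabel (v : V) : P.run (x.relabel σ) r v = P.run x r (σ.symm v) := by
  induction r generalizing v with
  | zero => rfl
  | succ r ih =>
    have hmessage (v w : V) :
        P.messageAt (x.relabel σ) r v w = P.messageAt x r (σ.symm v) (σ.symm w) := by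
      simp only [messageAt, ih, message_relabel]
    simp only [run_succ, ih, hmessage]
    simp [Config.relabel]

variable [Fintype V]

theorem recipients_relabel (v : V) :
    P.recipients (x.relabel σ) r v = (P.recipients x r (σ.symm v)).map σ.toEmbedding := by
  ext w
  simp [mem_recipients, mem_map_equiv, messageAt, message_relabel, run_relabel]

theorem sent_relabel : P.sent (x.relabel σ) r = P.sent x r := by
  simp only [sent, recipients_relabel, card_map]
  exact sum_congr rfl fun k _ => Equiv.sum_comp σ.symm fun v => #(P.recipients x k v)

theorem spread_relabel (A : Finset V) :
    P.spread (x.relabel σ) (A.map σ.toEmbedding) r = (P.spread x A r).map σ.toEmbedding := by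
  induction r with
  | zero => rfl
  | succ r ih =>
    ext w
    simp only [spread, ih, recipients_relabel, mem_map_equiv, mem_union, mem_biUnion]
    rw [σ.symm.exists_congr_left]
    simp

theorem touched_relabel :
    P.touched t (x.relabel σ) r = (P.touched t x r).map σ.toEmbedding := by
  rw [touched, touched, ← spread_relabel]
  congr 1
  ext v
  simp only [mem_active, mem_map_equiv, Config.relabel]

theorem electsTouched_relabel : P.ElectsTouched t (x.relabel σ) ↔ P.ElectsTouched t x := by
  simp only [ElectsTouched, touched_relabel, run_relabel, mem_map_equiv]
  rw [σ.symm.exists_congr_left]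
  simp

end Protocol

end Relabel

section Shuffle

variable {V ι S : Type*}

/-- A node `i` with `v ∈ T i`; if there is none, then the value is `v`. -/
noncomputable def owner (T : V → Finset V) (v : V) : V :=
  open Classical in if h : ∃ i, v ∈ T i then h.choose else v

theorem owner_eq {T : V → Finset V} (hT : Pairwise (Disjoint on T)) {i v : V} (hv : v ∈ T i) :
    owner T v = i := by
  have h : ∃ i, v ∈ T i := ⟨i, hv⟩
  rw [owner, dif_pos h]
  by_contra hne
  exact disjoint_left.1 (hT hne) h.choose_spec hv

variable [DecidableEq V]

/-- Exchanges, for every node `v`, what the configurations `X v` and `X (o v)` assign to `v`. -/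
def shuffle (o : V → V) (X : V → Config V ι S) : V → Config V ι S :=
  fun i v => X (Equiv.swap v (o v) i) v

theorem shuffle_involutive (o : V → V) :
    Involutive (shuffle o : (V → Config V ι S) → V → Config V ι S) := by
  intro X
  funext i v
  simp [shuffle]

theorem glue_shuffle_id (o : V → V) (X : V → Config V ι S) :
    Protocol.glue (shuffle o X) id = Protocol.glue X o := by
  funext v
  simp [shuffle, Protocol.glue]

end Shuffle

namespace Protocol

variable {V ι S : Type*} [Fintype V] [DecidableEq V] (P : Protocol ι S) (t m : ℕ)

/-- Every configuration `X i` has quiet seeds at all nodes other than `i`. -/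
def OffDiagonalQuiet (X : V → Config V ι S) : Prop :=
  ∀ i, ∀ v ≠ i, P.Quiet t (X i v).1

/-- The last time, up to `t`, until which the configurations `X i` together have sent at most `m`
messages. -/
def horizon (X : V → Config V ι S) : ℕ :=
  Nat.findGreatest (fun r => ∑ i, P.sent (X i) r ≤ m) t

/-- The nodes that an active node of the configuration `X i` has influenced until the horizon. -/
noncomputable def cloud (X : V → Config V ι S) (i : V) : Finset V :=
  P.touched t (X i) (P.horizon t m X)

/-- Moves the clouds to the diagonal: if they are disjoint, then the diagonal of the new family of
configurations runs like all clouds side by side. -/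
noncomputable def gather (X : V → Config V ι S) : V → Config V ι S :=
  shuffle (owner (P.cloud t m X)) X

variable {P t m} {X : V → Config V ι S}

theorem quiet_of_ne {r : ℕ} {o : V → V} (ho : ∀ i, ∀ v ∈ P.touched t (X i) r, o v = i) {v : V}
    (hv : o v ≠ v) : P.Quiet t (X v v).1 := by
  by_contra h
  exact hv (ho v v (by_contra fun hmem => h (quiet_of_notMem_touched hmem)))

theorem OffDiagonalQuiet.shuffle {r : ℕ} {o : V → V}
    (hX : P.OffDiagonalQuiet t X) (ho : ∀ i, ∀ v ∈ P.touched t (X i) r, o v = i) :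
    P.OffDiagonalQuiet t (shuffle o X) := by
  intro i v hvi
  by_cases h : Equiv.swap v (o v) i = v
  · have hiv : i = o v := by simpa using (Equiv.swap_apply_eq_iff.1 h)
    simpa only [LeaderElection.shuffle, h] using quiet_of_ne ho (hiv ▸ hvi.symm)
  · exact hX _ v (Ne.symm h)

theorem OffDiagonalQuiet.active_glue {r : ℕ} {o : V → V}
    (hX : P.OffDiagonalQuiet t X) (ho : ∀ i, ∀ v ∈ P.touched t (X i) r, o v = i) :
    P.active t (glue X o) = P.active t (glue X id) := by
  ext v
  by_cases hv : o v = v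
  · simp [mem_active, glue, hv]
  · simp [mem_active, glue, quiet_of_ne ho hv, hX (o v) v (Ne.symm hv)]

theorem OffDiagonalQuiet.active_eq_inter (hX : P.OffDiagonalQuiet t X) (i : V) :
    P.active t (X i) = P.active t (glue X id) ∩ {i} := by
  ext v
  obtain rfl | hv := eq_or_ne v i
  · simp [mem_active, glue]
  · simp [mem_active, hv, hX i v hv]

theorem horizon_le : P.horizon t m X ≤ t :=
  Nat.findGreatest_le t

theorem sum_sent_horizon_le : ∑ i, P.sent (X i) (P.horizon t m X) ≤ m :=
  Nat.findGreatest_spec (P := fun r => ∑ i, P.sent (X i) r ≤ m) t.zero_le (by simp [sent])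

theorem OffDiagonalQuiet.sum_card_cloud_le (hX : P.OffDiagonalQuiet t X) :
    ∑ i, #(P.cloud t m X i) ≤ #(P.active t (glue X id)) + m := by
  have hactive : ∑ i, #(P.active t (X i)) = #(P.active t (glue X id)) := by
    simp only [hX.active_eq_inter, inter_singleton, apply_ite card, card_singleton, card_empty]
    rw [sum_boole, filter_univ_mem, Nat.cast_id]
  calc ∑ i, #(P.cloud t m X i)
      ≤ ∑ i, (#(P.active t (X i)) + P.sent (X i) (P.horizon t m X)) :=
        sum_le_sum fun i _ => P.card_spread_le _ _ _
    _ ≤ #(P.active t (glue X id)) + m := by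
        rw [sum_add_distrib, hactive]
        exact Nat.add_le_add_left sum_sent_horizon_le _

section Gather

variable (hD : Pairwise (Disjoint on P.cloud t m X))
include hD

theorem horizon_eq_findGreatest :
    P.horizon t m X = Nat.findGreatest (fun r => P.sent (glue (P.gather t m X) id) r ≤ m) t := by
  have hsent {r : ℕ} (hr : r ≤ P.horizon t m X + 1) (hrt : r ≤ t) :
      P.sent (glue (P.gather t m X) id) r = ∑ i, P.sent (X i) r := by
    rw [gather, glue_shuffle_id]
    exact sent_glue horizon_le (fun i v => owner_eq hD) hr hrt
  refine (Nat.findGreatest_eq_iff.2 ⟨horizon_le, fun _ => ?_, fun r hr hrt hle => ?_⟩).symm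
  · exact (hsent (Nat.le_succ _) horizon_le).trans_le sum_sent_horizon_le
  · refine Nat.findGreatest_is_greatest (Nat.lt_succ_self (P.horizon t m X))
      ((Nat.succ_le_of_lt hr).trans hrt) ?_
    rw [← hsent le_rfl ((Nat.succ_le_of_lt hr).trans hrt)]
    exact (P.sent_mono _ (Nat.succ_le_of_lt hr)).trans hle

theorem existsUnique_electsTouched_of_gather
    (h : P.ElectsCheaply t m (glue (P.gather t m X) id)) : ∃! i, P.ElectsTouched t (X i) := by
  have hhorizon : P.horizon t m X = t := by
    rw [horizon_eq_findGreatest hD]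
    exact Nat.findGreatest_eq h.2
  rw [gather, glue_shuffle_id] at h
  exact existsUnique_electsTouched
    (fun i v hv => owner_eq hD (by rwa [cloud, hhorizon])) h.1

theorem OffDiagonalQuiet.gather (hX : P.OffDiagonalQuiet t X) :
    P.OffDiagonalQuiet t (P.gather t m X) :=
  hX.shuffle fun _ _ => owner_eq hD

theorem OffDiagonalQuiet.active_gather (hX : P.OffDiagonalQuiet t X) :
    P.active t (glue (P.gather t m X) id) = P.active t (glue X id) := by
  rw [Protocol.gather, glue_shuffle_id]
  exact hX.active_glue fun _ _ => owner_eq hD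

theorem OffDiagonalQuiet.cloud_eq_spread (hX : P.OffDiagonalQuiet t X) (i : V) :
    P.cloud t m X i = P.spread (glue (P.gather t m X) id)
      (P.active t (glue (P.gather t m X) id) ∩ {i})
      (Nat.findGreatest (fun r => P.sent (glue (P.gather t m X) id) r ≤ m) t) := by
  rw [← horizon_eq_findGreatest hD, hX.active_gather hD, ← hX.active_eq_inter, Protocol.gather,
    glue_shuffle_id]
  exact touched_eq_spread_glue horizon_le (fun i v => owner_eq hD) i le_rfl

end Gather

-- Disjoint clouds can be read off the gathered diagonal, so the exchange can be undone.
theorem gather_injOn : Set.InjOn (P.gather t m)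
    {X : V → Config V ι S | P.OffDiagonalQuiet t X ∧ Pairwise (Disjoint on P.cloud t m X)} := by
  rintro X ⟨hX, hDX⟩ Y ⟨hY, hDY⟩ h
  have hcloud : P.cloud t m X = P.cloud t m Y := by
    funext i
    rw [hX.cloud_eq_spread hDX, hY.cloud_eq_spread hDY, h]
  refine (shuffle_involutive (owner (P.cloud t m X))).injective ?_
  rwa [gather, gather, ← hcloud] at h

end Protocol

namespace Protocol

variable {V ι S : Type*} [Fintype V] [DecidableEq V] {P : Protocol ι S} {t m : ℕ}

section RelabelRow

variable (X : V → Config V ι S) (i : V) (σ : Equiv.Perm V)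

theorem horizon_update_relabel :
    P.horizon t m (update X i ((X i).relabel σ)) = P.horizon t m X := by
  have hsent (r : ℕ) (j : V) :
      P.sent (update X i ((X i).relabel σ) j) r = P.sent (X j) r := by
    obtain rfl | hj := eq_or_ne j i
    · rw [update_self, sent_relabel]
    · rw [update_of_ne hj]
  simp only [horizon, hsent]

theorem cloud_update_relabel :
    P.cloud t m (update X i ((X i).relabel σ)) =
      update (P.cloud t m X) i ((P.cloud t m X i).map σ.toEmbedding) := by
  funext j
  rw [cloud, horizon_update_relabel]
  obtain rfl | hj := eq_or_ne j i
  · simp only [update_self, touched_relabel, cloud]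
  · simp only [update_of_ne hj, cloud]

variable {X i σ}

omit [Fintype V] in
theorem OffDiagonalQuiet.update_relabel (hX : P.OffDiagonalQuiet t X) (hσ : σ i = i) :
    P.OffDiagonalQuiet t (update X i ((X i).relabel σ)) := by
  intro j v hv
  obtain rfl | hj := eq_or_ne j i
  · rw [update_self]
    exact hX j _ fun h => hv (by rwa [Equiv.symm_apply_eq, hσ] at h)
  · rw [update_of_ne hj]
    exact hX j v hv

theorem active_glue_update_relabel (hσ : σ i = i) :
    P.active t (glue (update X i ((X i).relabel σ)) id) = P.active t (glue X id) := by
  ext v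
  obtain rfl | hv := eq_or_ne v i
  · have hseed : (X v (σ.symm v)).1 = (X v v).1 := by rw [(Equiv.symm_apply_eq σ).2 hσ.symm]
    simp [mem_active, glue, Config.relabel, hseed]
  · simp [mem_active, glue, hv]

end RelabelRow

variable [Fintype ι] [DecidableEq ι] [Fintype S]

section ExactlyOne

variable (P t) in
/-- The configurations in which only the node `i` may have a seed that is not quiet. -/
noncomputable def rows (i : V) : Finset (Config V ι S) :=
  {x | ∀ v ≠ i, P.Quiet t (x v).1}

theorem mem_piFinset_rows {X : V → Config V ι S} :
    X ∈ Fintype.piFinset (P.rows t) ↔ P.OffDiagonalQuiet t X := by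
  simp [rows, OffDiagonalQuiet]

open Classical in
theorem card_filter_rows_le {p : Config V ι S → Prop} (hp : ∀ σ x, p x → p (x.relabel σ))
    (i j : V) : #{x ∈ P.rows t i | p x} ≤ #{x ∈ P.rows t j | p x} := by
  refine card_le_card_of_injOn (Config.relabel (Equiv.swap i j)) (fun x hx => ?_)
    (Config.relabel_injective _).injOn
  simp only [rows, coe_filter, mem_filter, mem_univ, true_and, Set.mem_ofPred_eq] at hx ⊢
  refine ⟨fun v hv => hx.1 ((Equiv.swap i j).symm v) fun h => hv ?_, hp _ x hx.2⟩
  rw [(Equiv.symm_apply_eq (Equiv.swap i j)).1 h, Equiv.swap_apply_left]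

open Classical in
theorem mul_card_existsUnique_electsTouched_le :
    ((Fintype.card V - 1 : ℕ) : ℝ) *
        #{X ∈ Fintype.piFinset (P.rows (V := V) t) | ∃! i, P.ElectsTouched t (X i)} ≤
      Fintype.card V * Real.exp (-1) * #(Fintype.piFinset (P.rows (V := V) t)) := by
  obtain hV | ⟨⟨i₀⟩⟩ := isEmpty_or_nonempty V
  · simp
  have hcard {p : Config V ι S → Prop} (hp : ∀ σ x, p x → p (x.relabel σ)) (i : V) :
      #{x ∈ P.rows t i | p x} = #{x ∈ P.rows t i₀ | p x} :=
    (card_filter_rows_le hp i i₀).antisymm (card_filter_rows_le hp i₀ i)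
  exact mul_card_filter_piFinset_existsUnique_le (p := fun _ x => P.ElectsTouched t x)
    (R := #(P.rows t i₀)) (w := #{x ∈ P.rows t i₀ | P.ElectsTouched t x})
    (fun i => by simpa using hcard (p := fun _ => True) (fun _ _ => id) i)
    (hcard fun σ x => (P.electsTouched_relabel σ x t).2)

end ExactlyOne

section Collision

variable (P t m) in
open Classical in
/-- The families of configurations with quiet seeds off the diagonal and with as few active nodes
on the diagonal as a cheap election allows. -/
noncomputable def sparse : Finset (V → Config V ι S) :=
  {X | P.OffDiagonalQuiet t X ∧ #(P.active t (glue X id)) ≤ 2 * m + 1}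

theorem mem_sparse {X : V → Config V ι S} :
    X ∈ P.sparse t m ↔ P.OffDiagonalQuiet t X ∧ #(P.active t (glue X id)) ≤ 2 * m + 1 := by
  simp [sparse]

theorem card_mem_cloud_le {i j a a' b : V} (hij : i ≠ j) (ha : a ≠ i) (ha' : a' ≠ i) :
    #{X ∈ P.sparse t m | a ∈ P.cloud t m X i ∧ b ∈ P.cloud t m X j} ≤
      #{X ∈ P.sparse t m | a' ∈ P.cloud t m X i ∧ b ∈ P.cloud t m X j} := by
  have hi : Equiv.swap a a' i = i := Equiv.swap_apply_of_ne_of_ne ha.symm ha'.symm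
  refine card_le_card_of_injOn (fun X => update X i ((X i).relabel (Equiv.swap a a')))
    (fun X hX => ?_) fun X _ Y _ h => ?_
  · simp only [coe_filter, mem_sparse, Set.mem_ofPred_eq, cloud_update_relabel, update_self,
      update_of_ne hij.symm, active_glue_update_relabel hi, mem_map_equiv, Equiv.symm_swap,
      Equiv.swap_apply_right] at hX ⊢
    exact ⟨⟨hX.1.1.update_relabel hi, hX.1.2⟩, hX.2⟩
  · funext k
    have hk := congrFun h k
    obtain rfl | hki := eq_or_ne k i
    · exact Config.relabel_injective _ (by simpa only [update_self] using hk)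
    · simpa only [update_of_ne hki] using hk

open Classical in
theorem sub_one_mul_card_colliding_le :
    (Fintype.card V - 1) * #{X ∈ P.sparse t m | ¬Pairwise (Disjoint on P.cloud (V := V) t m X)} ≤
      (3 * m + 1) ^ 2 * #(P.sparse (V := V) t m) := by
  refine (sub_one_mul_card_not_pairwise_disjoint_le fun i j hij a a' b ha ha' =>
    card_mem_cloud_le hij ha ha').trans ?_
  rw [mul_comm, ← smul_eq_mul]
  refine sum_le_card_nsmul _ _ _ fun X hX => Nat.pow_le_pow_left ?_ 2
  obtain ⟨hquiet, hactive⟩ := mem_sparse.1 hX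
  have := hquiet.sum_card_cloud_le (m := m)
  lia

end Collision

open Classical in
theorem card_offDiagonalQuiet (p : Config V ι S → Prop) :
    #{X : V → Config V ι S | P.OffDiagonalQuiet t X ∧ p (glue X id)} =
      (∏ v : V, #{c : S × (ι ≃ {w : V // w ≠ v}) | P.Quiet t c.1} ^ (Fintype.card V - 1)) *
        #{x | p x} := by
  rw [← card_filter_diagonal]
  congr 1
  ext X
  simp only [mem_filter, mem_univ, true_and]
  rfl

open Classical in
theorem mul_card_sparse_electsCheaply_le :
    ((Fintype.card V - 1 : ℕ) : ℝ) *
        #{X ∈ P.sparse (V := V) t m | P.ElectsCheaply t m (glue X id)} ≤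
      ((3 * m + 1) ^ 2 + Fintype.card V * Real.exp (-1)) *
        #(Fintype.piFinset (P.rows (V := V) t)) := by
  have hsubset : P.sparse (V := V) t m ⊆ Fintype.piFinset (P.rows t) := fun X hX =>
    mem_piFinset_rows.2 (mem_sparse.1 hX).1
  have hmaps : ∀ X ∈ P.sparse t m, Pairwise (Disjoint on P.cloud (V := V) t m X) →
      P.gather t m X ∈ P.sparse t m := fun X hX hD => by
    obtain ⟨hquiet, hactive⟩ := mem_sparse.1 hX
    exact mem_sparse.2 ⟨hquiet.gather hD, (hquiet.active_gather hD).symm ▸ hactive⟩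
  have hsplit := card_filter_le_of_injOn (P := fun X => P.ElectsCheaply t m (glue X id)) hmaps
    (gather_injOn.mono fun X hX => And.intro (mem_sparse.1 hX.1).1 hX.2)
  have hgood : #{X ∈ P.sparse t m | Pairwise (Disjoint on P.cloud t m X) ∧
      P.ElectsCheaply t m (glue (P.gather t m X) id)} ≤
      #{X ∈ Fintype.piFinset (P.rows (V := V) t) | ∃! i, P.ElectsTouched t (X i)} :=
    card_le_card fun X hX => by
      obtain ⟨hX, hD, helects⟩ := mem_filter.1 hX
      exact mem_filter.2 ⟨hsubset hX, existsUnique_electsTouched_of_gather hD helects⟩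
  have hcollide : ((Fintype.card V - 1 : ℕ) : ℝ) *
      #{X ∈ P.sparse (V := V) t m | ¬Pairwise (Disjoint on P.cloud t m X)} ≤
      (3 * m + 1) ^ 2 * #(Fintype.piFinset (P.rows (V := V) t)) :=
    mod_cast sub_one_mul_card_colliding_le.trans (Nat.mul_le_mul_left _ (card_le_card hsubset))
  calc ((Fintype.card V - 1 : ℕ) : ℝ) *
        #{X ∈ P.sparse (V := V) t m | P.ElectsCheaply t m (glue X id)}
      ≤ ((Fintype.card V - 1 : ℕ) : ℝ) *
          (#{X ∈ P.sparse (V := V) t m | ¬Pairwise (Disjoint on P.cloud t m X)} +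
            #{X ∈ Fintype.piFinset (P.rows (V := V) t) | ∃! i, P.ElectsTouched t (X i)}) := by
        gcongr
        exact_mod_cast hsplit.trans (Nat.add_le_add_left hgood _)
    _ ≤ ((3 * m + 1) ^ 2 + Fintype.card V * Real.exp (-1)) *
          #(Fintype.piFinset (P.rows (V := V) t)) := by
        linarith [mul_card_existsUnique_electsTouched_le (V := V) (P := P) (t := t)]

theorem prod_card_quiet_pos {x : Config V ι S} (hx : #(P.active t x) < Fintype.card V) :
    0 < ∏ v : V, #{c : S × (ι ≃ {w : V // w ≠ v}) | P.Quiet t c.1} ^ (Fintype.card V - 1) := by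
  obtain ⟨u, hu⟩ : ∃ u, u ∉ P.active t x := by
    by_contra! h
    exact hx.ne (card_eq_iff_eq_univ _ |>.2 (eq_univ_iff_forall.2 h))
  have hquiet : P.Quiet t (x u).1 := by rwa [mem_active, not_not] at hu
  exact prod_pos fun v _ => pow_pos
    (card_pos.2 ⟨((x u).1, (x v).2), mem_filter.2 ⟨mem_univ _, hquiet⟩⟩) _

theorem mul_card_electsCheaply_le (hmn : 2 * m + 1 < Fintype.card V) :
    ((Fintype.card V - 1 : ℕ) : ℝ) * #{x : Config V ι S | P.ElectsCheaply t m x} ≤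
      ((3 * m + 1) ^ 2 + Fintype.card V * Real.exp (-1)) * Fintype.card (Config V ι S) := by
  obtain hempty | ⟨x, hx⟩ :=
    ({x | P.ElectsCheaply t m x} : Finset (Config V ι S)).eq_empty_or_nonempty
  · rw [hempty, card_empty, Nat.cast_zero, mul_zero]
    positivity
  have hκ := prod_card_quiet_pos ((mem_filter.1 hx).2.card_active_le.trans_lt hmn)
  set κ := ∏ v : V, #{c : S × (ι ≃ {w : V // w ≠ v}) | P.Quiet t c.1} ^ (Fintype.card V - 1)
  have helects : #{X ∈ P.sparse (V := V) t m | P.ElectsCheaply t m (glue X id)} =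
      κ * #{x : Config V ι S | P.ElectsCheaply t m x} := by
    rw [← card_offDiagonalQuiet]
    congr 1
    ext X
    simp only [mem_filter, mem_sparse, mem_univ, true_and]
    exact ⟨fun h => ⟨h.1.1, h.2⟩, fun h => ⟨⟨h.1, h.2.card_active_le⟩, h.2⟩⟩
  have hrows : #(Fintype.piFinset (P.rows (V := V) t)) = κ * Fintype.card (Config V ι S) := by
    rw [← card_univ, ← filter_true (s := univ), ← card_offDiagonalQuiet fun _ => True]
    congr 1
    ext X
    simp only [mem_piFinset_rows, mem_filter, mem_univ, true_and, and_true]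
  have hsparse := mul_card_sparse_electsCheaply_le (V := V) (P := P) (t := t) (m := m)
  rw [helects, hrows] at hsparse
  push_cast at hsparse
  refine le_of_mul_le_mul_left ?_ (Nat.cast_pos.2 hκ : (0 : ℝ) < κ)
  linarith

end Protocol

section Probability

variable {Ω : Type*} [MeasurableSpace Ω] {μ : Measure Ω} [IsProbabilityMeasure μ]

open Classical in
theorem exists_sum_measureReal_le_card {κ : Type*} [Fintype κ] {B : κ → Set Ω}
    (hB : ∀ y, MeasurableSet (B y)) : ∃ ω, ∑ y, μ.real (B y) ≤ #{y | ω ∈ B y} := by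
  have hintegrable (y : κ) : Integrable ((B y).indicator (1 : Ω → ℝ)) μ :=
    (integrable_const (1 : ℝ)).indicator (hB y)
  obtain ⟨ω, hω⟩ := exists_integral_le (integrable_finsetSum univ fun y _ => hintegrable y)
  refine ⟨ω, ?_⟩
  rw [integral_finsetSum _ fun y _ => hintegrable y,
    sum_congr rfl fun y _ => integral_indicator_one (hB y)] at hω
  simpa [Set.indicator_apply] using hω

theorem eventually_le_measureReal_of_subset {E : ℕ → Set Ω} {F : Set Ω} {δ : ℝ}
    (hF : F ⊆ ⋃ T, ⋂ t ≥ T, E t) (hδ : δ < μ.real F) : ∀ᶠ t in atTop, δ ≤ μ.real (E t) := by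
  have hmono : Monotone fun T => ⋂ t ≥ T, E t := fun T T' hT =>
    Set.biInter_mono (fun t ht => hT.trans ht) fun _ _ => Set.Subset.rfl
  have hlim : Tendsto (fun T => μ.real (⋂ t ≥ T, E t)) atTop (nhds (μ.real (⋃ T, ⋂ t ≥ T, E t))) :=
    (ENNReal.tendsto_toReal (measure_ne_top _ _)).comp (tendsto_measure_iUnion_atTop hmono)
  filter_upwards [hlim.eventually_const_lt (hδ.trans_le (measureReal_mono hF))] with t ht
  exact ht.le.trans (measureReal_mono (Set.iInter₂_subset t le_rfl))

theorem measurePreserving_pi_comp {ι κ : Type*} [Fintype ι] [Fintype κ] {k : ι → κ}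
    (hk : Injective k) :
    MeasurePreserving (fun s : κ → Ω => s ∘ k) (Measure.pi fun _ => μ) (Measure.pi fun _ => μ) := by
  have hindep := (ProbabilityTheory.iIndepFun_pi (μ := fun _ : κ => μ)
    (X := fun _ => (id : Ω → Ω)) fun _ => aemeasurable_id).precomp hk
  have hmeas : Measurable fun s : κ → Ω => s ∘ k :=
    measurable_pi_lambda _ fun i => measurable_pi_apply (k i)
  refine ⟨hmeas, ?_⟩
  refine ((ProbabilityTheory.iIndepFun_iff_map_fun_eq_pi_map fun i =>
    (measurable_pi_apply (k i)).aemeasurable).1 hindep).trans ?_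
  exact congrArg Measure.pi (funext fun i => (measurePreserving_eval _ (k i)).map_eq)

end Probability

instance (n : ℕ) : DiscreteMeasurableSpace (Ports n) := ⟨fun _ => trivial⟩

instance : IsProbabilityMeasure tapeMeasure := by
  unfold tapeMeasure
  infer_instance

instance (n : ℕ) : IsProbabilityMeasure (runMeasure n) := by
  unfold runMeasure
  infer_instance

theorem card_ports_mul_real_runMeasure {n : ℕ} {J : Type*} [Fintype J] (k : Fin n ↪ J)
    {E : Set (Outcome n)} (hE : MeasurableSet E) :
    Fintype.card (Ports n) * (runMeasure n).real E =
      ∑ π, (Measure.pi fun _ : J => tapeMeasure).real {s | (π, s ∘ k) ∈ E} := by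
  have hpreimage (π : Ports n) : (Measure.pi fun _ : J => tapeMeasure).real {s | (π, s ∘ k) ∈ E} =
      (Measure.pi fun _ : Fin n => tapeMeasure).real (Prod.mk π ⁻¹' E) :=
    (measurePreserving_pi_comp k.injective).measureReal_preimage
      (measurable_prodMk_left hE).nullMeasurableSet
  have hcard : (Fintype.card (Ports n) : ℝ) ≠ 0 := Nat.cast_ne_zero.2 Fintype.card_ne_zero
  simp only [hpreimage]
  rw [Measure.real, runMeasure, Measure.prod_apply hE, lintegral_fintype,
    ENNReal.toReal_sum fun π _ => ENNReal.mul_ne_top (measure_ne_top _ _) (measure_ne_top _ _),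
    mul_sum]
  refine sum_congr rfl fun π _ => ?_
  rw [PMF.toMeasure_apply_singleton _ _ (MeasurableSet.singleton π), PMF.uniformOfFintype_apply,
    ENNReal.toReal_mul, ENNReal.toReal_inv, ENNReal.toReal_natCast, mul_left_comm,
    mul_inv_cancel₀ hcard, mul_one, Measure.real]

namespace Algorithm

variable {n : ℕ} {I : Type} (A : Algorithm n I)

section Events

variable (ids : Fin n → I)

/-- The event that at time `t` there is exactly one elected node, all others are non-elected, and
at most `m` messages have been sent. -/
def electsAt (t m : ℕ) : Set (Outcome n) :=
  {x | (∃ v, A.status (A.state ids x t v) = Status.elected ∧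
    ∀ w, w ≠ v → A.status (A.state ids x t w) = Status.nonElected) ∧ A.messages ids x t ≤ m}

theorem electsLeader_inter_sendsAtMost_subset (b : ℝ) :
    A.electsLeader ids ∩ A.sendsAtMost ids b ⊆ ⋃ T, ⋂ t ≥ T, A.electsAt ids t ⌊b⌋₊ := by
  rintro x ⟨⟨T, hT⟩, hx⟩
  simp only [Set.mem_iUnion, Set.mem_iInter]
  exact ⟨T, fun t ht => ⟨hT t ht, Nat.le_floor (hx t)⟩⟩

attribute [local instance] measurableSpaceState countableMsg

theorem measurable_recv_comp {Ω : Type*} [MeasurableSpace Ω] {g : Ω → A.State}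
    (hg : Measurable g) {b : Ω → Fin (n - 1) → Option A.Msg}
    (hb : ∀ p c, MeasurableSet {x | b x p = c}) : Measurable fun x => A.recv (g x) (b x) := by
  let : MeasurableSpace (Option A.Msg) := ⊤
  have hrecv : Measurable fun y : A.State × (Fin (n - 1) → Option A.Msg) => A.recv y.1 y.2 :=
    measurable_from_prod_countable_left A.measurable_recv
  exact hrecv.comp (hg.prodMk (measurable_pi_lambda _ fun p => measurable_to_countable' (hb p)))

theorem measurable_state (t : ℕ) (v : Fin n) :
    Measurable fun x : Outcome n => A.state ids x t v := by
  refine measurable_from_prod_countable_right fun π => ?_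
  induction t generalizing v with
  | zero => exact (A.measurable_init (ids v)).comp (measurable_pi_apply v)
  | succ t ih =>
    exact A.measurable_recv_comp (ih v) fun p c =>
      ih (π v p) (A.measurableSet_send ((π (π v p)).symm ⟨v, (π v p).2.symm⟩) c)

theorem measurable_messages (r : ℕ) : Measurable fun x : Outcome n => A.messages ids x r := by
  simp only [messages, card_filter, Option.isSome_iff_ne_none]
  exact measurable_sum _ fun t _ => measurable_sum _ fun v _ => measurable_sum _ fun p _ =>
    Measurable.ite (A.measurable_state ids t v (A.measurableSet_send p none)).compl
      measurable_const measurable_const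

theorem measurableSet_electsAt (t m : ℕ) : MeasurableSet (A.electsAt ids t m) := by
  have hstatus (v : Fin n) (s : Status) :
      Measurable fun x : Outcome n => A.status (A.state ids x t v) = s :=
    measurableSet_setOfPred.1 (A.measurable_state ids t v (A.measurableSet_status s))
  exact measurableSet_setOfPred.2 ((Measurable.exists fun v => (hstatus v _).and
    (Measurable.forall fun w => measurable_const.imp (hstatus w _))).and
      (measurableSet_setOfPred.1 (A.measurable_messages ids t measurableSet_Iic)))

theorem measurableSet_sendsAtMost (b : ℝ) : MeasurableSet (A.sendsAtMost ids b) :=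
  measurableSet_setOfPred.2 (Measurable.forall fun r => measurableSet_setOfPred.1
    (measurableSet_le (measurable_from_nat.comp (A.measurable_messages ids r)) measurable_const))

end Events

section Protocol

variable {J : Type*} (ids : J → I) (s : J → Tape)

/-- The deterministic protocol that an algorithm becomes once a list `ids` of inputs and a list `s`
of coin flip sequences are fixed: the seed of a node is its position in the two lists. -/
def protocol : Protocol (Fin (n - 1)) J where
  State := A.State
  Msg := A.Msg
  init j := A.init (ids j) (s j)
  send := A.send
  recv := A.recv
  status := A.status

theorem state_eq_run (k : Fin n → J) (π : Ports n) (t : ℕ) (v : Fin n) :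
    A.state (ids ∘ k) (π, s ∘ k) t v = (A.protocol ids s).run (fun v => (k v, π v)) t v := by
  induction t generalizing v with
  | zero => rfl
  | succ t ih =>
    simp only [state, ih]
    refine congrArg _ (funext fun p => ?_)
    rw [Protocol.message, dif_pos (π v p).2.symm]
    rfl

theorem messages_eq_sent (k : Fin n → J) (π : Ports n) (r : ℕ) :
    A.messages (ids ∘ k) (π, s ∘ k) r = (A.protocol ids s).sent (fun v => (k v, π v)) r := by
  simp only [messages, Protocol.sent, Protocol.card_recipients, state_eq_run]
  rfl

theorem electsCheaply_of_mem_electsAt {k : Fin n → J} {π : Ports n} {t m : ℕ}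
    (h : (π, s ∘ k) ∈ A.electsAt (ids ∘ k) t m) :
    (A.protocol ids s).ElectsCheaply t m fun v => (k v, π v) := by
  obtain ⟨⟨v, hv, hothers⟩, hmessages⟩ := h
  simp only [state_eq_run] at hv hothers
  refine ⟨⟨v, hv, fun w hw => ?_⟩, A.messages_eq_sent ids s k π t ▸ hmessages⟩
  by_contra hne
  exact Status.noConfusion ((hothers w hne).symm.trans hw)

end Protocol

section Sampling

variable {J : Type*} [Fintype J] (ids : J → I) {t m : ℕ}

open Classical in
theorem exists_sum_real_electsAt_le_card :
    ∃ s : J → Tape, ∑ k : Fin n ↪ J,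
      Fintype.card (Ports n) * (runMeasure n).real (A.electsAt (ids ∘ k) t m) ≤
        #{x : Config (Fin n) (Fin (n - 1)) J | (A.protocol ids s).ElectsCheaply t m x} := by
  have hmeas (y : (Fin n ↪ J) × Ports n) :
      MeasurableSet {s : J → Tape | (y.2, s ∘ y.1) ∈ A.electsAt (ids ∘ y.1) t m} :=
    (measurable_const.prodMk
      (measurePreserving_pi_comp (μ := tapeMeasure) y.1.injective).measurable)
      (A.measurableSet_electsAt _ t m)
  obtain ⟨s, hs⟩ :=
    exists_sum_measureReal_le_card (μ := Measure.pi fun _ : J => tapeMeasure) hmeas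
  refine ⟨s, ?_⟩
  rw [sum_congr rfl fun k _ => card_ports_mul_real_runMeasure k (A.measurableSet_electsAt _ t m),
    ← Fintype.sum_prod_type']
  refine hs.trans (Nat.cast_le.2 (card_le_card_of_injOn (fun y v => (y.1 v, y.2 v))
    (fun y hy => ?_) fun y _ z _ hyz => ?_))
  · simp only [coe_filter, mem_univ, true_and, Set.mem_ofPred_eq] at hy ⊢
    exact A.electsCheaply_of_mem_electsAt ids s hy
  · exact Prod.ext (DFunLike.ext _ _ fun v => congrArg Prod.fst (congrFun hyz v))
      (funext fun v => congrArg Prod.snd (congrFun hyz v))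

theorem mul_descFactorial_le_of_le_real_electsAt (hmn : 2 * m + 1 < n) {δ : ℝ}
    (hδ : ∀ k : Fin n ↪ J, δ ≤ (runMeasure n).real (A.electsAt (ids ∘ k) t m)) :
    ((n - 1 : ℕ) : ℝ) * (δ * (Fintype.card J).descFactorial n) ≤
      ((3 * m + 1) ^ 2 + n * Real.exp (-1)) * (Fintype.card J : ℝ) ^ n := by
  classical
  obtain ⟨s, hs⟩ := A.exists_sum_real_electsAt_le_card ids (t := t) (m := m)
  have hsum : (Fintype.card J).descFactorial n * (Fintype.card (Ports n) * δ) ≤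
      ∑ k : Fin n ↪ J, Fintype.card (Ports n) * (runMeasure n).real (A.electsAt (ids ∘ k) t m) := by
    have hcard : Fintype.card (Fin n ↪ J) = (Fintype.card J).descFactorial n := by simp
    rw [← hcard, ← nsmul_eq_mul]
    exact card_nsmul_le_sum _ _ _ fun k _ => by gcongr; exact hδ k
  have hcard : Fintype.card (Config (Fin n) (Fin (n - 1)) J) =
      Fintype.card J ^ n * Fintype.card (Ports n) := by
    simp [Fintype.card_pi, prod_mul_distrib]
  have hcount := (A.protocol ids s).mul_card_electsCheaply_le (V := Fin n) (t := t) (m := m)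
    (by rwa [Fintype.card_fin])
  rw [hcard, Fintype.card_fin] at hcount
  push_cast at hcount
  have hports : (0 : ℝ) < Fintype.card (Ports n) := Nat.cast_pos.2 Fintype.card_pos
  refine le_of_mul_le_mul_right ?_ hports
  calc ((n - 1 : ℕ) : ℝ) * (δ * (Fintype.card J).descFactorial n) * Fintype.card (Ports n)
      = ((n - 1 : ℕ) : ℝ) *
          ((Fintype.card J).descFactorial n * (Fintype.card (Ports n) * δ)) := by ring
    _ ≤ ((n - 1 : ℕ) : ℝ) *
          #{x : Config (Fin n) (Fin (n - 1)) J | (A.protocol ids s).ElectsCheaply t m x} := by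
        gcongr
        exact hsum.trans hs
    _ ≤ _ := by linarith

theorem mul_descFactorial_le (b : ℝ) (hbn : 2 * ⌊b⌋₊ + 1 < n) {δ : ℝ}
    (hδ : ∀ k : Fin n ↪ J, δ <
      (runMeasure n).real (A.electsLeader (ids ∘ k) ∩ A.sendsAtMost (ids ∘ k) b)) :
    ((n - 1 : ℕ) : ℝ) * (δ * (Fintype.card J).descFactorial n) ≤
      ((3 * ⌊b⌋₊ + 1) ^ 2 + n * Real.exp (-1)) * (Fintype.card J : ℝ) ^ n := by
  have hlate : ∀ᶠ t in atTop, ∀ k : Fin n ↪ J,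
      δ ≤ (runMeasure n).real (A.electsAt (ids ∘ k) t ⌊b⌋₊) :=
    eventually_all.2 fun k => eventually_le_measureReal_of_subset
      (A.electsLeader_inter_sendsAtMost_subset (ids ∘ k) b) (hδ k)
  obtain ⟨t, ht⟩ := hlate.exists
  exact A.mul_descFactorial_le_of_le_real_electsAt ids hbn ht

end Sampling

end Algorithm

theorem one_sub_mul_pow_le_descFactorial {n N : ℕ} (hn : n ≤ N) :
    (1 - (n : ℝ) ^ 2 / N) * N ^ n ≤ N.descFactorial n := by
  obtain rfl | hN := N.eq_zero_or_pos
  · simp [Nat.le_zero.1 hn]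
  have hNr : (0 : ℝ) < N := Nat.cast_pos.2 hN
  have hnN : (n : ℝ) / N ≤ 1 := (div_le_one hNr).2 (Nat.cast_le.2 hn)
  have hbernoulli := one_add_mul_le_pow (a := -((n : ℝ) / N)) (by linarith) n
  calc (1 - (n : ℝ) ^ 2 / N) * N ^ n = (1 + n * -((n : ℝ) / N)) * N ^ n := by ring
    _ ≤ (1 + -((n : ℝ) / N)) ^ n * N ^ n := by gcongr
    _ = ((N : ℝ) - n) ^ n := by
        rw [← mul_pow, add_mul, one_mul, neg_mul, div_mul_cancel₀ _ hNr.ne', ← sub_eq_add_neg]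
    _ ≤ ((N + 1 - n : ℕ) : ℝ) ^ n := by
        have : ((N - n : ℕ) : ℝ) ≤ ((N + 1 - n : ℕ) : ℝ) := Nat.cast_le.2 (by lia)
        rw [← Nat.cast_sub hn]
        gcongr
    _ ≤ N.descFactorial n := mod_cast Nat.pow_sub_le_descFactorial N n

theorem floor_sq_le {b c x : ℝ} (hc : 0 ≤ c) (hx : 0 ≤ x) (hb : b ≤ c * √x) :
    (⌊b⌋₊ : ℝ) ^ 2 ≤ c ^ 2 * x := by
  have hfloor : (⌊b⌋₊ : ℝ) ≤ c * √x :=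
    (Nat.cast_le.2 (Nat.floor_mono hb)).trans (Nat.floor_le (by positivity))
  calc (⌊b⌋₊ : ℝ) ^ 2 ≤ (c * √x) ^ 2 := by gcongr
    _ = c ^ 2 * x := by rw [mul_pow, Real.sq_sqrt hx]

theorem eventually_mul_add_lt {N : ℕ → ℕ}
    (hN : Tendsto (fun n => (N n : ℝ) / (n : ℝ) ^ 2) atTop atTop) {r q : ℝ} (hrq : r < q) (C : ℝ) :
    ∀ᶠ n : ℕ in atTop, r * n + C < ((n - 1 : ℕ) : ℝ) * (q * (1 - (n : ℝ) ^ 2 / N n)) := by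
  have hinv : Tendsto (fun n : ℕ => (n : ℝ)⁻¹) atTop (nhds 0) := tendsto_inv_atTop_nhds_zero_nat
  have hleft : Tendsto (fun n : ℕ => r + C * (n : ℝ)⁻¹) atTop (nhds r) := by
    simpa using tendsto_const_nhds.add (hinv.const_mul C)
  have hright : Tendsto (fun n : ℕ => (1 - (n : ℝ)⁻¹) * (q * (1 - (n : ℝ) ^ 2 / N n))) atTop
      (nhds q) := by
    have hratio : Tendsto (fun n : ℕ => (n : ℝ) ^ 2 / N n) atTop (nhds 0) := by
      simpa only [Pi.inv_def, inv_div] using hN.inv_tendsto_atTop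
    simpa using (hinv.const_sub 1).mul ((hratio.const_sub 1).const_mul q)
  filter_upwards [hleft.eventually_lt hright hrq, eventually_ge_atTop 1] with n hlt hn
  have hn₀ : (0 : ℝ) < n := Nat.cast_pos.2 hn
  calc r * n + C = n * (r + C * (n : ℝ)⁻¹) := by field_simp
    _ < n * ((1 - (n : ℝ)⁻¹) * (q * (1 - (n : ℝ) ^ 2 / N n))) := by gcongr
    _ = ((n - 1 : ℕ) : ℝ) * (q * (1 - (n : ℝ) ^ 2 / N n)) := by
        rw [← mul_assoc, mul_sub, mul_one, mul_inv_cancel₀ hn₀.ne', Nat.cast_pred hn]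

theorem tendsto_pow_four_div_sq :
    Tendsto (fun n : ℕ => ((n ^ 4 : ℕ) : ℝ) / (n : ℝ) ^ 2) atTop atTop := by
  refine ((tendsto_pow_atTop two_ne_zero).comp tendsto_natCast_atTop_atTop).congr' ?_
  filter_upwards [eventually_gt_atTop 0] with n hn
  have : (n : ℝ) ≠ 0 := Nat.cast_ne_zero.2 hn.ne'
  simp only [comp_apply, Nat.cast_pow]
  field_simp

theorem exists_embedding_of_le_card {N : ℕ} {X : Type} (h : (N : ℕ∞) ≤ ENat.card X) :
    Nonempty (Fin N ↪ X) := by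
  rw [← Cardinal.le_def, Cardinal.mk_fin]
  exact Cardinal.natCast_le_toENat.1 h

theorem Algorithm.eventually_le_real_electsLeader_inter {I : ℕ → Type} {X : ℕ → Type*}
    (A : ∀ n, Algorithm n (I n)) (f : ℕ → ℝ) {ε a : ℝ} (hε : 0 < ε) (ha : 0 < a)
    (ids : ∀ n, X n → Fin n → I n)
    (hsends : ∀ᶠ n : ℕ in atTop, ∀ x : X n, 1 - 1 / (n : ℝ) ^ a ≤
      (runMeasure n).real ((A n).sendsAtMost (ids n x) (f n)))
    (helects : ∀ᶠ n : ℕ in atTop, ∀ x : X n, 1 / Real.exp 1 + ε ≤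
      (runMeasure n).real ((A n).electsLeader (ids n x))) :
    ∀ᶠ n : ℕ in atTop, ∀ x : X n, 1 / Real.exp 1 + ε / 2 ≤
      (runMeasure n).real ((A n).electsLeader (ids n x) ∩ (A n).sendsAtMost (ids n x) (f n)) := by
  have hpow : Tendsto (fun n : ℕ => 1 / (n : ℝ) ^ a) atTop (nhds 0) := by
    simpa only [one_div, Pi.inv_def, comp_apply] using
      ((tendsto_rpow_atTop ha).comp tendsto_natCast_atTop_atTop).inv_tendsto_atTop
  filter_upwards [hsends, helects, hpow.eventually_lt_const (half_pos hε)] with n hs he hn x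
  have hinter := measureReal_union_add_inter (μ := runMeasure n)
    (s := (A n).electsLeader (ids n x)) ((A n).measurableSet_sendsAtMost (ids n x) (f n))
  have hunion : (runMeasure n).real
      ((A n).electsLeader (ids n x) ∪ (A n).sendsAtMost (ids n x) (f n)) ≤ 1 := measureReal_le_one
  linarith [hs x, he x]

theorem Algorithm.pred_mul_mul_one_sub_le {n : ℕ} {I : Type} (A : Algorithm n I) {N : ℕ}
    (hnN : n ≤ N) (ids : Fin N → I) (b : ℝ) (hbn : 2 * ⌊b⌋₊ + 1 < n) {δ : ℝ} (hδ₀ : 0 ≤ δ)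
    (hδ : ∀ k : Fin n ↪ Fin N, δ < (runMeasure n).real
      (A.electsLeader (ids ∘ k) ∩ A.sendsAtMost (ids ∘ k) b)) :
    ((n - 1 : ℕ) : ℝ) * (δ * (1 - (n : ℝ) ^ 2 / N)) ≤
      (3 * ⌊b⌋₊ + 1) ^ 2 + n * Real.exp (-1) := by
  have hN : (0 : ℝ) < N := Nat.cast_pos.2 (by lia)
  refine le_of_mul_le_mul_right ?_ (pow_pos hN n)
  calc ((n - 1 : ℕ) : ℝ) * (δ * (1 - (n : ℝ) ^ 2 / N)) * N ^ n
      = ((n - 1 : ℕ) : ℝ) * (δ * ((1 - (n : ℝ) ^ 2 / N) * N ^ n)) := by ring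
    _ ≤ ((n - 1 : ℕ) : ℝ) * (δ * N.descFactorial n) := by
        gcongr
        exact one_sub_mul_pow_le_descFactorial hnN
    _ ≤ ((3 * ⌊b⌋₊ + 1) ^ 2 + n * Real.exp (-1)) * N ^ n := by
        simpa only [Fintype.card_fin] using A.mul_descFactorial_le ids b hbn hδ

theorem eventually_le_of_tendsto_div_sq {N : ℕ → ℕ}
    (hN : Tendsto (fun n => (N n : ℝ) / (n : ℝ) ^ 2) atTop atTop) : ∀ᶠ n in atTop, n ≤ N n := by
  filter_upwards [hN.eventually_ge_atTop 1, eventually_gt_atTop 0] with n hone hn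
  have hsq : (n : ℝ) ^ 2 ≤ N n := (one_le_div (by positivity)).1 hone
  exact (Nat.le_self_pow two_ne_zero n).trans (mod_cast hsq)

end LeaderElection

theorem theorem3_general {I : ℕ → Type} (A : ∀ n, LeaderElection.Algorithm n (I n)) (f : ℕ → ℝ)
    {ε : ℝ} (hε : 0 < ε) {N : ℕ → ℕ}
    (hN : Tendsto (fun n => (N n : ℝ) / (n : ℝ) ^ 2) atTop atTop)
    (h : ∀ᶠ n in atTop, ∃ ids : Fin (N n) → I n, ∀ k : Fin n ↪ Fin (N n),
      1 / Real.exp 1 + ε ≤ (LeaderElection.runMeasure n).real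
        ((A n).electsLeader (ids ∘ k) ∩ (A n).sendsAtMost (ids ∘ k) (f n))) :
    ∃ c : ℝ, 0 < c ∧ ∀ᶠ n : ℕ in atTop, c * √(n : ℝ) ≤ f n := by
  have hc : (√ε / 8) ^ 2 = ε / 64 := by rw [div_pow, Real.sq_sqrt hε.le]; norm_num
  have hgap : Real.exp (-1) + ε * (9 / 32) < Real.exp (-1) + ε / 2 := by linarith
  refine ⟨√ε / 8, by positivity, ?_⟩
  filter_upwards [h, LeaderElection.eventually_mul_add_lt hN hgap 2,
    LeaderElection.eventually_le_of_tendsto_div_sq hN, eventually_ge_atTop 2,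
    tendsto_natCast_atTop_atTop.eventually_ge_atTop ε] with n ⟨ids, hids⟩ hlt hnN hn hεn
  by_contra! hf
  have hfloor := LeaderElection.floor_sq_le (by positivity) n.cast_nonneg hf.le
  rw [hc] at hfloor
  have hn' : (2 : ℝ) ≤ n := mod_cast hn
  have hsmall : 2 * ⌊f n⌋₊ + 1 < n := by
    have : (⌊f n⌋₊ : ℝ) ≤ n / 8 := le_of_sq_le_sq (by nlinarith) (by positivity)
    exact_mod_cast (by linarith : 2 * (⌊f n⌋₊ : ℝ) + 1 < n)
  have hupper := (A n).pred_mul_mul_one_sub_le hnN ids (f n) hsmall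
    (δ := Real.exp (-1) + ε / 2) (by positivity) fun k => by
      rw [Real.exp_neg, ← one_div]
      linarith [hids k]
  linarith [sq_nonneg (3 * (⌊f n⌋₊ : ℝ) - 1)]

theorem theorem3 :
    -- anonymous nodes
    (∀ (A : ∀ n : ℕ, LeaderElection.Algorithm n Unit) (f : ℕ → ℝ) (ε a : ℝ), 0 < ε → 0 < a →
      (∀ᶠ n : ℕ in atTop, 1 - 1 / (n : ℝ) ^ a ≤
        (LeaderElection.runMeasure n).real ((A n).sendsAtMost (fun _ => ()) (f n))) →
      (∀ᶠ n : ℕ in atTop, 1 / Real.exp 1 + ε ≤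
        (LeaderElection.runMeasure n).real ((A n).electsLeader (fun _ => ()))) →
      ∃ c : ℝ, 0 < c ∧ ∀ᶠ n : ℕ in atTop, c * √(n : ℝ) ≤ f n) ∧
    -- unique identifiers, chosen by an adversary from a set of at least `n ^ 4` identifiers
    (∀ (I : ℕ → Type), (∀ᶠ n : ℕ in atTop, ((n ^ 4 : ℕ) : ℕ∞) ≤ ENat.card (I n)) →
      ∀ (A : ∀ n : ℕ, LeaderElection.Algorithm n (I n)) (f : ℕ → ℝ) (ε a : ℝ), 0 < ε → 0 < a →
      (∀ᶠ n : ℕ in atTop, ∀ ids : Fin n ↪ I n, 1 - 1 / (n : ℝ) ^ a ≤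
        (LeaderElection.runMeasure n).real ((A n).sendsAtMost ids (f n))) →
      (∀ᶠ n : ℕ in atTop, ∀ ids : Fin n ↪ I n, 1 / Real.exp 1 + ε ≤
        (LeaderElection.runMeasure n).real ((A n).electsLeader ids)) →
      ∃ c : ℝ, 0 < c ∧ ∀ᶠ n : ℕ in atTop, c * √(n : ℝ) ≤ f n) := by
  refine ⟨fun A f ε a hε ha hsends helects => ?_, fun I hI A f ε a hε ha hsends helects => ?_⟩
  · refine theorem3_general A f (half_pos hε) LeaderElection.tendsto_pow_four_div_sq ?_
    filter_upwards [LeaderElection.Algorithm.eventually_le_real_electsLeader_inter A f hε ha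
      (fun _ (_ : Unit) _ => ()) (hsends.mono fun _ h _ => h) (helects.mono fun _ h _ => h)]
      with n h
    exact ⟨fun _ => (), fun _ => h ()⟩
  · refine theorem3_general A f (half_pos hε) LeaderElection.tendsto_pow_four_div_sq ?_
    filter_upwards [hI, LeaderElection.Algorithm.eventually_le_real_electsLeader_inter A f hε ha
      (fun n (ids : Fin n ↪ I n) => ids) hsends helects] with n hcard h
    obtain ⟨ids⟩ := LeaderElection.exists_embedding_of_le_card hcard
    exact ⟨ids, fun k => h (k.trans ids)⟩
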